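/- \textbf{Definitions.} A \emph{system} consists of a finite-dimensional real vector space $A$, a regular cone $A_+\subset A$ (a convex cone that linearly generates $A$, contains no nontrivial subspace and is closed), and an element $u$ in the interior of the dual cone $A^*_+=\{f\in A^*: f\ge 0\text{ on }A_+\}$. Its \emph{normalized states} form the set $\Omega=\{x\in A_+ : u(x)=1\}$; the \emph{pure states} are the extreme points of $\Omega$. The base norm on $A$ is $\|x\|=\inf\{u(a)+u(b): x=a-b,\ a,b\in A_+\}$; a linear map $A\to A$ is \emph{normalized} if it does not increase the base norm. A positive linear projection $P$ on a space $E$ with cone $E_+$ is \emph{complemented} if there is a positive linear projection $P'$ with $\operatorname{im}P\cap E_+=\ker P'\cap E_+$ and $\ker P\cap E_+=\operatorname{im}P'\cap E_+$. A \emph{filter} is a normalized, complemented, positive linear projection $P:A\to A$ whose adjoint $P^*: a\mapsto a\circ P$ on $(A^*,A^*_+)$ is also complemented; the adjoints of filters are the \emph{compressions} on $A^*$, and the effects $u\circ P$ with $P$ a filter are the \emph{projective units}. An \emph{atomic} projective unit is a minimal nonzero element of the set of projective units in the order given by $A^*_+$. The system is \emph{projective} if each face of $\Omega$ has the form $\operatorname{im}P\cap\Omega$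 for a filter $P$. In a projective system every atomic projective unit $x$ takes the value $1$ on a unique normalized state $\hat x$, which is pure, and every pure state $\omega$ has a unique atomic projective unit $\tilde\omega$ with $\tilde\omega(\omega)=1$. The system satisfies \emph{Symmetry of Transition Probabilities} if $\tilde\omega(\sigma)=\tilde\sigma(\omega)$ for all pure states $\omega,\sigma$. A cone is \emph{perfect} with respect to an inner product on its ambient space if each of its faces $F$ (including the cone itself) is self-dual in its linear span for the restricted inner product, i.e. $F=\{y\in\operatorname{lin}F: (y,x)\ge 0\ \forall x\in F\}$; it is perfect if it is so for some inner product. A \emph{perfect system} is a system for which $A_+$ is perfect with respect to some inner product such that, for every face $F$ of $A_+$, the orthogonal projection of $A$ onto $\operatorname{lin}F$ is normalized. \textbf{Theorem.} Let $A$ be a finite-dimensional projective system satisfying Symmetry of Transition Probabilities. Then there is a unique positive linear map $\phi:A^*\to A$ (i.e. $\phi(A^*_+)\subseteq A_+$) such that $\phi(x)=\hat x$ for each atomic projective unit $x$. The form $(x,y):=\langle x,\phi(y)\rangle = x(\phi(y))$ is an inner product on $A^*$, and every compression $P$ on $A^*$ is symmetric for it: $(Pa,b)=(a,Pb)$ for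 all $a,b\in A^*$. Moreover $A^*_+$ is a self-dual cone that is perfect with respect to $(\cdot,\cdot)$, the cone $A_+$ is perfect (and self-dual) as well, and the system $A$ is a perfect system. -/

import Mathlib

noncomputable section

/-- The cone dual to `C`: the linear functionals that are nonnegative on `C`. -/
def dualCone {A : Type*} [NormedAddCommGroup A] [NormedSpace ℝ A] (C : PointedCone ℝ A) :
    PointedCone ℝ (StrongDual ℝ A) :=
  PointedCone.dual (topDualPairing ℝ A).flip (C : Set A)

theorem mem_dualCone {A : Type*} [NormedAddCommGroup A] [NormedSpace ℝ A]
    {C : PointedCone ℝ A} {f : StrongDual ℝ A} : f ∈ dualCone C ↔ ∀ x ∈ C, 0 ≤ f x :=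
  Iff.rfl

/-- A cone is regular if it generates the space linearly, contains no nontrivial subspace and is
topologically closed. -/
structure IsRegularCone {A : Type*} [NormedAddCommGroup A] [NormedSpace ℝ A]
    (C : PointedCone ℝ A) : Prop where
  generates : Submodule.span ℝ (C : Set A) = ⊤
  no_subspace : ∀ V : Submodule ℝ A, (V : Set A) ⊆ (C : Set A) → V = ⊥
  isClosed : IsClosed (C : Set A)

/-- A system on the space `A`: a regular cone `A₊` of unnormalized states and an order unit in the
interior of the cone of unnormalized effects, the latter being the full dual cone of `A₊`. -/
structure GPTSystem (A : Type*) [NormedAddCommGroup A] [NormedSpace ℝ A] where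
  cone : PointedCone ℝ A
  regular : IsRegularCone cone
  unit : StrongDual ℝ A
  unit_mem : unit ∈ interior (dualCone cone : Set (StrongDual ℝ A))

namespace GPTSystem

/-- The set `Ω` of normalized states. -/
def states {A : Type*} [NormedAddCommGroup A] [NormedSpace ℝ A] (S : GPTSystem A) : Set A :=
  {x | x ∈ S.cone ∧ S.unit x = 1}

/-- Pure states are the extreme points of `Ω`. -/
def IsPure {A : Type*} [NormedAddCommGroup A] [NormedSpace ℝ A] (S : GPTSystem A) (ω : A) : Prop :=
  ω ∈ Set.extremePoints ℝ S.states

/-- The base norm: the infimum of `u(a) + u(b)` over all decompositions `x = a - b` with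
`a` and `b` in `A₊`. -/
def baseNorm {A : Type*} [NormedAddCommGroup A] [NormedSpace ℝ A] (S : GPTSystem A) (x : A) : ℝ :=
  sInf {r : ℝ | ∃ a ∈ S.cone, ∃ b ∈ S.cone, x = a - b ∧ r = S.unit a + S.unit b}

/-- A linear map is normalized if it does not increase the base norm. -/
def IsNormalized {A : Type*} [NormedAddCommGroup A] [NormedSpace ℝ A] (S : GPTSystem A)
    (P : A →L[ℝ] A) : Prop :=
  ∀ x, S.baseNorm (P x) ≤ S.baseNorm x

/-- On `A₊` the base norm is the order unit. -/
theorem baseNorm_of_mem {A : Type*} [NormedAddCommGroup A] [NormedSpace ℝ A] (S : GPTSystem A)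
    {x : A} (hx : x ∈ S.cone) : S.baseNorm x = S.unit x := by
  have hu : ∀ y ∈ S.cone, 0 ≤ S.unit y := mem_dualCone.1 (interior_subset S.unit_mem)
  have hlb : ∀ r ∈ {r : ℝ | ∃ a ∈ S.cone, ∃ b ∈ S.cone, x = a - b ∧ r = S.unit a + S.unit b},
      S.unit x ≤ r := by
    rintro r ⟨a, _, b, hb, rfl, rfl⟩
    have := hu b hb
    rw [map_sub]
    linarith
  have hmem : S.unit x ∈
      {r : ℝ | ∃ a ∈ S.cone, ∃ b ∈ S.cone, x = a - b ∧ r = S.unit a + S.unit b} :=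
    ⟨x, hx, 0, S.cone.zero_mem, by simp, by simp⟩
  exact le_antisymm (csInf_le ⟨_, hlb⟩ hmem) (le_csInf ⟨_, hmem⟩ hlb)

end GPTSystem

/-- A positive linear projection with respect to the cone `C`. -/
structure IsPositiveProjection {E : Type*} [NormedAddCommGroup E] [NormedSpace ℝ E]
    (C : PointedCone ℝ E) (P : E →L[ℝ] E) : Prop where
  positive : ∀ x ∈ C, P x ∈ C
  idem : ∀ x, P (P x) = P x

/-- `P` is complemented: there is a positive projection `P'` with `im₊ P = ker₊ P'` and
`ker₊ P = im₊ P'`. -/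
def IsComplementedProjection {E : Type*} [NormedAddCommGroup E] [NormedSpace ℝ E]
    (C : PointedCone ℝ E) (P : E →L[ℝ] E) : Prop :=
  ∃ P' : E →L[ℝ] E, IsPositiveProjection C P' ∧
    Set.range P ∩ (C : Set E) = {x | P' x = 0} ∩ (C : Set E) ∧
    {x | P x = 0} ∩ (C : Set E) = Set.range P' ∩ (C : Set E)

/-- The adjoint `a ↦ a ∘ P` of a linear map `P`, acting on the dual space. -/
def adjointMap {A : Type*} [NormedAddCommGroup A] [NormedSpace ℝ A] (P : A →L[ℝ] A) :
    StrongDual ℝ A →L[ℝ] StrongDual ℝ A :=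
  (ContinuousLinearMap.compL ℝ A A ℝ).flip P

@[simp] theorem adjointMap_apply {A : Type*} [NormedAddCommGroup A] [NormedSpace ℝ A]
    (P : A →L[ℝ] A) (a : StrongDual ℝ A) (x : A) : adjointMap P a x = a (P x) :=
  rfl

namespace GPTSystem

/-- A filter is a normalized, bicomplemented, positive linear projection `A → A`, where
bicomplemented means complemented with complemented adjoint. -/
structure IsFilter {A : Type*} [NormedAddCommGroup A] [NormedSpace ℝ A] (S : GPTSystem A)
    (P : A →L[ℝ] A) : Prop where
  projection : IsPositiveProjection S.cone P
  normalized : S.IsNormalized P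
  complemented : IsComplementedProjection S.cone P
  adjoint_complemented : IsComplementedProjection (dualCone S.cone) (adjointMap P)

/-- A compression is the adjoint, acting on `A*`, of a filter. -/
def IsCompression {A : Type*} [NormedAddCommGroup A] [NormedSpace ℝ A] (S : GPTSystem A)
    (T : StrongDual ℝ A →L[ℝ] StrongDual ℝ A) : Prop :=
  ∃ P : A →L[ℝ] A, S.IsFilter P ∧ T = adjointMap P

/-- A system is projective if each face of `Ω` is the positive normalized part of the image of a
filter. -/
def IsProjective {A : Type*} [NormedAddCommGroup A] [NormedSpace ℝ A] (S : GPTSystem A) : Prop :=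
  ∀ F : Set A, Convex ℝ F → IsExtreme ℝ S.states F →
    ∃ P : A →L[ℝ] A, S.IsFilter P ∧ F = Set.range P ∩ S.states

/-- A projective unit is an effect `u ∘ P` with `P` a filter. -/
def IsProjectiveUnit {A : Type*} [NormedAddCommGroup A] [NormedSpace ℝ A] (S : GPTSystem A)
    (x : StrongDual ℝ A) : Prop :=
  ∃ P : A →L[ℝ] A, S.IsFilter P ∧ x = adjointMap P S.unit

/-- An atomic projective unit (atomic effect): an atom among the projective units, these being
ordered by the dual cone. -/
structure IsAtomicUnit {A : Type*} [NormedAddCommGroup A] [NormedSpace ℝ A] (S : GPTSystem A)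
    (x : StrongDual ℝ A) : Prop where
  isProjectiveUnit : S.IsProjectiveUnit x
  ne_zero : x ≠ 0
  minimal : ∀ y, S.IsProjectiveUnit y → y ≠ 0 → x - y ∈ dualCone S.cone → y = x

/-- `ω` is the pure state `x̂` of the effect `x`: it is the one and only normalized state on which
`x` takes the value `1`, and it is pure. -/
structure IsHat {A : Type*} [NormedAddCommGroup A] [NormedSpace ℝ A] (S : GPTSystem A)
    (x : StrongDual ℝ A) (ω : A) : Prop where
  pure : S.IsPure ω
  apply_eq_one : x ω = 1
  unique : ∀ σ ∈ S.states, x σ = 1 → σ = ω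

/-- Symmetry of Transition Probabilities: `ω̃(σ) = σ̃(ω)` for all pure states `ω`, `σ`, where `ω̃`
denotes the atomic effect that takes the value `1` on `ω`. -/
def SymmetricTransitionProbabilities {A : Type*} [NormedAddCommGroup A] [NormedSpace ℝ A]
    (S : GPTSystem A) : Prop :=
  ∀ ω σ : A, S.IsPure ω → S.IsPure σ →
    ∀ x y : StrongDual ℝ A, S.IsAtomicUnit x → x ω = 1 → S.IsAtomicUnit y → y σ = 1 → x σ = y ω

end GPTSystem

/-- The bilinear form is an inner product: symmetric and positive definite. -/
def IsInnerProduct {E : Type*} [AddCommGroup E] [Module ℝ E]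
    (B : LinearMap.BilinForm ℝ E) : Prop :=
  (∀ x y, B x y = B y x) ∧ ∀ x, x ≠ 0 → 0 < B x x

/-- The cone `C` is self-dual in its own linear span, with respect to the restriction of `B`. -/
def IsSelfDualInSpan {E : Type*} [AddCommGroup E] [Module ℝ E]
    (C : PointedCone ℝ E) (B : LinearMap.BilinForm ℝ E) : Prop :=
  (C : Set E) = {y | y ∈ Submodule.span ℝ (C : Set E) ∧ ∀ x ∈ C, 0 ≤ B y x}

/-- `C` is perfect with respect to `B`: the form `B` is an inner product on the whole space, `C`
is self-dual for `B` there, and each face of `C` is self-dual in its linear span with respect to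
the restriction of `B`. -/
structure IsPerfectFor {E : Type*} [AddCommGroup E] [Module ℝ E]
    (C : PointedCone ℝ E) (B : LinearMap.BilinForm ℝ E) : Prop where
  inner : IsInnerProduct B
  selfDual : (C : Set E) = {y | ∀ x ∈ C, 0 ≤ B y x}
  faces : ∀ F : PointedCone ℝ E, F.IsFaceOf C → IsSelfDualInSpan F B

/-- A cone is perfect if there is an inner product with respect to which it is perfect. -/
def IsPerfectCone {E : Type*} [AddCommGroup E] [Module ℝ E] (C : PointedCone ℝ E) : Prop :=
  ∃ B : LinearMap.BilinForm ℝ E, IsPerfectFor C B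

/-- `P` is the `B`-orthogonal projection onto the subspace `V`. -/
def IsOrthogonalProjection {E : Type*} [AddCommGroup E] [Module ℝ E]
    (B : LinearMap.BilinForm ℝ E) (V : Submodule ℝ E) (P : E → E) : Prop :=
  ∀ x, P x ∈ V ∧ ∀ y ∈ V, B (x - P x) y = 0

namespace GPTSystem

/-- A perfect system: `A₊` is perfect, and for each face `F` of `A₊` the orthogonal projection
`P_F` onto the linear span of `F` is normalized. -/
def IsPerfectSystem {A : Type*} [NormedAddCommGroup A] [NormedSpace ℝ A] (S : GPTSystem A) :
    Prop :=
  ∃ B : LinearMap.BilinForm ℝ A, IsPerfectFor S.cone B ∧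
    ∀ F : PointedCone ℝ A, F.IsFaceOf S.cone →
      ∃ P : A →L[ℝ] A,
        IsOrthogonalProjection B (Submodule.span ℝ (F : Set A)) P ∧ S.IsNormalized P

/-- `φ : A* → A` is positive and sends each atomic projective unit `x` to the pure state `x̂`. -/
structure IsHatMap {A : Type*} [NormedAddCommGroup A] [NormedSpace ℝ A] (S : GPTSystem A)
    (φ : StrongDual ℝ A →ₗ[ℝ] A) : Prop where
  positive : ∀ a ∈ dualCone S.cone, φ a ∈ S.cone
  map_atomic : ∀ x, S.IsAtomicUnit x → S.IsHat x (φ x)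

end GPTSystem

/-- The bilinear form `(a, b) = ⟨a, φ b⟩` on the dual space. -/
def pairingForm {A : Type*} [NormedAddCommGroup A] [NormedSpace ℝ A]
    (φ : StrongDual ℝ A →ₗ[ℝ] A) : LinearMap.BilinForm ℝ (StrongDual ℝ A) :=
  LinearMap.mk₂ ℝ (fun a b => a (φ b)) (fun _ _ _ => by simp) (fun _ _ _ => by simp)
    (fun _ _ _ => by simp) (fun _ _ _ => by simp)

@[simp] theorem pairingForm_apply {A : Type*} [NormedAddCommGroup A] [NormedSpace ℝ A]
    (φ : StrongDual ℝ A →ₗ[ℝ] A) (a b : StrongDual ℝ A) : pairingForm φ a b = a (φ b) :=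
  rfl

end

/-!
The argument rests on the filter `P` of a single pure state `ω`. It maps the cone of states into
the ray of `ω`, so its compression kills every effect that vanishes at `ω`, and such an effect is
fixed by the complement `Q` of the compression. Applied to `t • u - a`, this shows that a
functional `a` which is bounded by `t` on the states and takes the value `t` at `ω` splits as
`t • x + Q a`, where `x = u ∘ P` (`GPTSystem.exists_isAtomSplitting`). The following consequences
carry the proof.

* Pure states and atomic units correspond to each other, and subtracting maxima repeatedly writes
  every positive functional as a positive combination of atomic units
  (`GPTSystem.dualCone_le_hull`). Hence the atomic units span the dual space, and a linear map `φ`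
  prescribed on a basis of atomic units takes the right value on all of them, by symmetry of
  transition probabilities (`GPTSystem.exists_linearMap_isHat`).
* The splitting `a = t • x + Q a` is orthogonal for the form `(a, b) = a (φ b)`, so that
  `(a, a) = t ^ 2 + (Q a, Q a)` with `Q a` again bounded by `t`. If the form is bounded below by
  `-(n + 1) t ^ 2` on the functionals bounded by `t`, it is therefore bounded below by `-n t ^ 2`,
  and positive definiteness follows by descent (`GPTSystem.IsHatMap.pairing_self_pos`).
* The map `φ` sends the image of a compression into the image of its filter, because the positive
  part of the former is a face and so generated by atomic units. This makes compressions symmetric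
  (`GPTSystem.IsHatMap.pairing_adjointMap`).
* Every face of the cone of states is the positive image of a filter. Symmetric filters are the
  orthogonal projections onto the spans of the faces, and they reduce the self-duality of a face to
  that of the cone (`GPTSystem.isPerfectFor_cone`). The map `φ`, an order isomorphism, carries this
  over to the dual cone.
-/

namespace IsComplementedProjection

/-- The complement `P'` of a positive projection `P`, described by its action on the cone. -/
theorem exists_complement {E : Type*} [NormedAddCommGroup E] [NormedSpace ℝ E]
    {C : PointedCone ℝ E} {P : E →L[ℝ] E} (hP : IsPositiveProjection C P)
    (h : IsComplementedProjection C P) :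
    ∃ P' : E →L[ℝ] E, IsPositiveProjection C P' ∧
      (∀ x ∈ C, P' x = 0 → P x = x) ∧ (∀ x ∈ C, P x = 0 → P' x = x) ∧
      (∀ x ∈ C, P' (P x) = 0) := by
  obtain ⟨P', hP', h₁, h₂⟩ := h
  refine ⟨P', hP', fun x hx h0 => ?_, fun x hx h0 => ?_, fun x hx => ?_⟩
  · have : x ∈ {x | P' x = 0} ∩ (C : Set E) := ⟨h0, hx⟩
    rw [← h₁] at this
    obtain ⟨⟨y, rfl⟩, -⟩ := this
    exact hP.idem y
  · have : x ∈ {x | P x = 0} ∩ (C : Set E) := ⟨h0, hx⟩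
    rw [h₂] at this
    obtain ⟨⟨y, rfl⟩, -⟩ := this
    exact hP'.idem y
  · have : P x ∈ Set.range P ∩ (C : Set E) := ⟨⟨x, rfl⟩, hP.positive x hx⟩
    rw [h₁] at this
    exact this.1

end IsComplementedProjection

namespace GPTSystem

variable {A : Type*} [NormedAddCommGroup A] [NormedSpace ℝ A] {S : GPTSystem A}

/-! ### The order unit and the compact base of states -/

theorem unit_mem_dualCone (S : GPTSystem A) : S.unit ∈ dualCone S.cone :=
  interior_subset S.unit_mem

/-- Since the order unit is interior to the dual cone, it dominates a multiple of the norm on the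
cone of states. -/
theorem exists_pos_mul_norm_le_unit (S : GPTSystem A) :
    ∃ δ > 0, ∀ x ∈ S.cone, δ * ‖x‖ ≤ S.unit x := by
  obtain ⟨ε, hε, hball⟩ := Metric.mem_nhds_iff.1 (mem_interior_iff_mem_nhds.1 S.unit_mem)
  refine ⟨ε / 2, by positivity, fun x hx => ?_⟩
  obtain ⟨g, hg, hgx⟩ := exists_dual_vector'' ℝ x
  have hmem : S.unit - (ε / 2) • g ∈ dualCone S.cone := by
    apply hball
    rw [Metric.mem_ball, dist_eq_norm, sub_sub_cancel_left, norm_neg, norm_smul,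
      Real.norm_of_nonneg (by positivity)]
    nlinarith
  have := mem_dualCone.1 hmem x hx
  simpa [hgx] using this

theorem unit_nonneg (S : GPTSystem A) {x : A} (hx : x ∈ S.cone) : 0 ≤ S.unit x :=
  mem_dualCone.1 S.unit_mem_dualCone x hx

theorem eq_zero_of_unit_eq_zero {x : A} (hx : x ∈ S.cone) (h : S.unit x = 0) : x = 0 := by
  obtain ⟨δ, hδ, hle⟩ := S.exists_pos_mul_norm_le_unit
  have := hle x hx
  rw [h] at this
  exact norm_le_zero_iff.1 (nonpos_of_mul_nonpos_right this hδ)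

theorem unit_pos {x : A} (hx : x ∈ S.cone) (h0 : x ≠ 0) : 0 < S.unit x :=
  (S.unit_nonneg hx).lt_of_ne' fun h => h0 (eq_zero_of_unit_eq_zero hx h)

theorem inv_unit_smul_mem_states {x : A} (hx : x ∈ S.cone) (h0 : x ≠ 0) :
    (S.unit x)⁻¹ • x ∈ S.states :=
  ⟨S.cone.smul_mem (inv_nonneg.2 (S.unit_nonneg hx)) hx, by
    simp [inv_mul_cancel₀ (unit_pos hx h0).ne']⟩

/-- Inequalities between functionals need only be checked on the normalized states. -/
theorem le_mul_unit_of_forall_states {f : StrongDual ℝ A} {t : ℝ}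
    (h : ∀ σ ∈ S.states, f σ ≤ t) {x : A} (hx : x ∈ S.cone) : f x ≤ t * S.unit x := by
  by_cases h0 : x = 0
  · simp [h0]
  have h1 := h _ (inv_unit_smul_mem_states hx h0)
  have hu := unit_pos hx h0
  rw [map_smul, smul_eq_mul, inv_mul_le_iff₀ hu] at h1
  linarith

theorem exists_abs_le_mul_unit (S : GPTSystem A) (f : StrongDual ℝ A) :
    ∃ t, 0 ≤ t ∧ ∀ x ∈ S.cone, |f x| ≤ t * S.unit x := by
  obtain ⟨δ, hδ, hle⟩ := S.exists_pos_mul_norm_le_unit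
  refine ⟨‖f‖ / δ, by positivity, fun x hx => ?_⟩
  calc |f x| ≤ ‖f‖ * ‖x‖ := f.le_opNorm x
    _ = ‖f‖ / δ * (δ * ‖x‖) := by field_simp
    _ ≤ _ := by gcongr; exact hle x hx

/-- The cone of states generates the space, so functionals agreeing on it are equal. -/
theorem eq_of_forall_mem_cone {f g : StrongDual ℝ A} (h : ∀ x ∈ S.cone, f x = g x) : f = g := by
  have := LinearMap.ext_on (f := f.toLinearMap) (g := g.toLinearMap) S.regular.generates
    (fun x hx => h x hx)
  exact ContinuousLinearMap.coe_injective this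

/-- The dual cone generates the dual space. -/
theorem exists_sub_mem_dualCone (S : GPTSystem A) (f : StrongDual ℝ A) :
    ∃ g ∈ dualCone S.cone, ∃ h ∈ dualCone S.cone, f = g - h := by
  obtain ⟨t, ht, hle⟩ := S.exists_abs_le_mul_unit f
  refine ⟨f + t • S.unit, ?_, t • S.unit, (dualCone S.cone).smul_mem ht S.unit_mem_dualCone,
    by simp⟩
  rw [mem_dualCone]
  intro x hx
  have := neg_le_of_abs_le (hle x hx)
  simp only [add_apply, smul_apply, smul_eq_mul]
  linarith

theorem isCompact_states [FiniteDimensional ℝ A] (S : GPTSystem A) : IsCompact S.states := by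
  obtain ⟨δ, hδ, hle⟩ := S.exists_pos_mul_norm_le_unit
  have : ProperSpace A := FiniteDimensional.proper ℝ A
  refine Metric.isCompact_of_isClosed_isBounded ?_ ?_
  · exact S.regular.isClosed.inter (isClosed_eq S.unit.continuous continuous_const)
  · refine isBounded_iff_forall_norm_le.2 ⟨δ⁻¹, fun x hx => ?_⟩
    have := hle x hx.1
    rw [hx.2] at this
    rwa [← one_div, le_div_iff₀ hδ, mul_comm]

/-- A functional attains its maximum over the normalized states at a pure state. -/
theorem exists_isPure_forall_le [FiniteDimensional ℝ A] (hne : S.states.Nonempty)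
    (f : StrongDual ℝ A) : ∃ ω, S.IsPure ω ∧ ∀ x ∈ S.cone, f x ≤ f ω * S.unit x := by
  have hexp : IsExposed ℝ S.states (f.toExposed S.states) :=
    ContinuousLinearMap.toExposed.isExposed
  obtain ⟨z, hz, hmax⟩ := S.isCompact_states.exists_isMaxOn hne f.continuous.continuousOn
  obtain ⟨ω, hω⟩ := (hexp.isCompact S.isCompact_states).extremePoints_nonempty
    ⟨z, hz, fun y hy => hmax hy⟩
  exact ⟨ω, hexp.isExtreme.extremePoints_subset_extremePoints hω,
    fun x hx => le_mul_unit_of_forall_states hω.1.2 hx⟩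

theorem IsPure.mem_cone {ω : A} (h : S.IsPure ω) : ω ∈ S.cone := h.1.1

theorem IsPure.unit_apply {ω : A} (h : S.IsPure ω) : S.unit ω = 1 := h.1.2

theorem mem_dualCone_of_forall_isPure [FiniteDimensional ℝ A] {f : StrongDual ℝ A}
    (h : ∀ ω, S.IsPure ω → 0 ≤ f ω) : f ∈ dualCone S.cone := by
  rw [mem_dualCone]
  intro x hx
  by_cases h0 : x = 0
  · simp [h0]
  obtain ⟨ω, hω, hmax⟩ := exists_isPure_forall_le ⟨_, inv_unit_smul_mem_states hx h0⟩ (-f)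
  have h1 := hmax x hx
  simp only [neg_apply] at h1
  nlinarith [h ω hω, S.unit_nonneg hx]

/-! ### Filters and their complements -/

namespace IsFilter

variable {P : A →L[ℝ] A}

theorem unit_apply_le (hP : S.IsFilter P) {x : A} (hx : x ∈ S.cone) :
    S.unit (P x) ≤ S.unit x := by
  rw [← S.baseNorm_of_mem hx, ← S.baseNorm_of_mem (hP.projection.positive x hx)]
  exact hP.normalized x

theorem adjoint_projection (hP : S.IsFilter P) :
    IsPositiveProjection (dualCone S.cone) (adjointMap P) where
  positive a ha := by
    rw [mem_dualCone] at ha ⊢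
    exact fun x hx => ha _ (hP.projection.positive x hx)
  idem a := by
    ext x
    simp [hP.projection.idem]

/-- The complement of a compression sends the order unit to the complementary projective unit. -/
theorem exists_adjoint_complement (hP : S.IsFilter P) :
    ∃ Q : StrongDual ℝ A →L[ℝ] StrongDual ℝ A, IsPositiveProjection (dualCone S.cone) Q ∧
      (∀ a ∈ dualCone S.cone, Q a = 0 → adjointMap P a = a) ∧
      (∀ a ∈ dualCone S.cone, adjointMap P a = 0 → Q a = a) ∧
      (∀ a ∈ dualCone S.cone, Q (adjointMap P a) = 0) ∧
      Q S.unit = S.unit - adjointMap P S.unit := by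
  obtain ⟨Q, hQ, h₁, h₂, h₄⟩ :=
    hP.adjoint_complemented.exists_complement hP.adjoint_projection
  refine ⟨Q, hQ, h₁, h₂, h₄, ?_⟩
  have hmem : S.unit - adjointMap P S.unit ∈ dualCone S.cone := by
    rw [mem_dualCone]
    intro x hx
    simpa using hP.unit_apply_le hx
  have := h₂ _ hmem (by rw [map_sub, hP.adjoint_projection.idem, sub_self])
  rwa [map_sub, h₄ _ S.unit_mem_dualCone, sub_zero] at this

/-- A state that passes a filter with certainty is left unchanged by it. The functional `u ∘ P'`,
with `P'` the complement of `P`, is dominated by a multiple of the complementary projective unit,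
so that `P'` kills such a state. -/
theorem apply_eq_self (hP : S.IsFilter P) {x : A} (hx : x ∈ S.cone)
    (h : S.unit (P x) = S.unit x) : P x = x := by
  obtain ⟨P', hP', h₁, -, h₄⟩ := hP.complemented.exists_complement hP.projection
  obtain ⟨Q, hQ, -, hQ₂, -, hQu⟩ := hP.exists_adjoint_complement
  refine h₁ x hx (eq_zero_of_unit_eq_zero (hP'.positive x hx) (le_antisymm ?_ ?_))
  swap
  · exact S.unit_nonneg (hP'.positive x hx)
  set s := adjointMap P' S.unit with hs
  have hsmem : s ∈ dualCone S.cone := by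
    rw [mem_dualCone]
    exact fun y hy => S.unit_nonneg (hP'.positive y hy)
  obtain ⟨c, -, hc⟩ := S.exists_abs_le_mul_unit s
  have hPs : adjointMap P s = 0 := by
    refine eq_of_forall_mem_cone (S := S) fun y hy => ?_
    simp [hs, h₄ y hy]
  have hQs : Q s = s := hQ₂ s hsmem hPs
  have hle : c • S.unit - s ∈ dualCone S.cone := by
    rw [mem_dualCone]
    intro y hy
    have := le_of_abs_le (hc y hy)
    simpa using this
  have h5 := mem_dualCone.1 (hQ.positive _ hle) x hx
  rw [map_sub, map_smul, hQs, hQu] at h5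
  simp only [sub_apply, smul_apply, adjointMap_apply, h,
    sub_self, smul_zero, zero_sub, hs] at h5
  simpa using h5

end IsFilter

/-! ### Pure states and atomic units -/

/-- The effect `x` is the projective unit of a filter onto the ray of the pure state `ω`, and `Q`
is the complement of the corresponding compression. The field `split` says that a functional `a`
which is bounded by `t` on the states and attains `t` at `ω` splits as `t • x + Q a`. -/
structure IsAtomSplitting (S : GPTSystem A) (x : StrongDual ℝ A) (ω : A)
    (Q : StrongDual ℝ A →L[ℝ] StrongDual ℝ A) : Prop where
  isProjectiveUnit : S.IsProjectiveUnit x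
  isHat : S.IsHat x ω
  projection : IsPositiveProjection (dualCone S.cone) Q
  map_unit : Q S.unit = S.unit - x
  split : ∀ (a : StrongDual ℝ A) (t : ℝ), (∀ z ∈ S.cone, a z ≤ t * S.unit z) → a ω = t →
    a = t • x + Q a

/-- In a projective system every pure state has a splitting: the filter `P` belonging to the face
`{ω}` maps the cone into the ray of `ω`, so a positive functional vanishing at `ω` is killed by
the compression and hence fixed by its complement. -/
theorem exists_isAtomSplitting (hproj : S.IsProjective) {ω : A} (hω : S.IsPure ω) :
    ∃ x Q, S.IsAtomSplitting x ω Q := by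
  obtain ⟨P, hP, hface⟩ := hproj {ω} (convex_singleton ω) (isExtreme_singleton.2 hω)
  obtain ⟨Q, hQ, -, hQ₂, -, hQu⟩ := hP.exists_adjoint_complement
  have hPω : P ω = ω := by
    have : ω ∈ Set.range P ∩ S.states := hface ▸ Set.mem_singleton ω
    obtain ⟨⟨y, rfl⟩, -⟩ := this
    exact hP.projection.idem y
  refine ⟨adjointMap P S.unit, Q, ⟨P, hP, rfl⟩, ⟨hω, ?_, ?_⟩, hQ, hQu, fun a t hat haω => ?_⟩
  · rw [adjointMap_apply, hPω, hω.unit_apply]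
  · intro σ hσ h1
    have h2 : P σ = σ := hP.apply_eq_self hσ.1 (by rw [hσ.2]; exact h1)
    have : σ ∈ Set.range P ∩ S.states := ⟨⟨σ, h2⟩, hσ⟩
    rw [← hface] at this
    exact this
  · have hmem : t • S.unit - a ∈ dualCone S.cone := by
      rw [mem_dualCone]
      intro z hz
      simpa using hat z hz
    have hker : adjointMap P (t • S.unit - a) = 0 := by
      refine eq_of_forall_mem_cone (S := S) fun z hz => ?_
      by_cases h0 : P z = 0
      · simp [h0]
      have hPz := hP.projection.positive z hz
      have : (S.unit (P z))⁻¹ • P z ∈ Set.range P ∩ S.states :=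
        ⟨⟨(S.unit (P z))⁻¹ • z, map_smul _ _ _⟩, inv_unit_smul_mem_states hPz h0⟩
      rw [← hface, Set.mem_singleton_iff] at this
      have h3 : P z = S.unit (P z) • ω := by
        rw [← this, smul_smul, mul_inv_cancel₀ (unit_pos hPz h0).ne', one_smul]
      rw [adjointMap_apply, h3]
      simp [haω, hω.unit_apply]
    have h4 := hQ₂ _ hmem hker
    rw [map_sub, map_smul, hQu, smul_sub] at h4
    linear_combination (norm := module) h4

namespace IsAtomSplitting

variable {x a : StrongDual ℝ A} {ω : A} {Q : StrongDual ℝ A →L[ℝ] StrongDual ℝ A} {t : ℝ}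

/-- A positive functional of maximum `t` attained at `ω` dominates `t • x`. -/
theorem sub_smul_mem_dualCone (h : S.IsAtomSplitting x ω Q) (ha : a ∈ dualCone S.cone)
    (hat : ∀ z ∈ S.cone, a z ≤ t * S.unit z) (haω : a ω = t) : a - t • x ∈ dualCone S.cone := by
  rw [sub_eq_of_eq_add' (h.split a t hat haω)]
  exact h.projection.positive a ha

end IsAtomSplitting

namespace IsProjectiveUnit

variable {y : StrongDual ℝ A}

theorem mem_dualCone (hy : S.IsProjectiveUnit y) : y ∈ dualCone S.cone := by
  obtain ⟨P, hP, rfl⟩ := hy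
  exact hP.adjoint_projection.positive _ S.unit_mem_dualCone

theorem apply_le_unit (hy : S.IsProjectiveUnit y) {z : A} (hz : z ∈ S.cone) :
    y z ≤ S.unit z := by
  obtain ⟨P, hP, rfl⟩ := hy
  exact hP.unit_apply_le hz

/-- A nonzero projective unit takes the value `1` on a normalized state. -/
theorem exists_mem_states (hy : S.IsProjectiveUnit y) (h0 : y ≠ 0) :
    ∃ σ ∈ S.states, y σ = 1 := by
  obtain ⟨P, hP, rfl⟩ := hy
  obtain ⟨z, hz, hPz⟩ : ∃ z ∈ S.cone, P z ≠ 0 := by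
    by_contra! hcon
    exact h0 (eq_of_forall_mem_cone (S := S) fun z hz => by simp [hcon z hz])
  have hmem := inv_unit_smul_mem_states (hP.projection.positive z hz) hPz
  refine ⟨_, hmem, ?_⟩
  rw [adjointMap_apply, map_smul, hP.projection.idem]
  exact hmem.2

end IsProjectiveUnit

/-- The dual cone is pointed. -/
theorem eq_of_sub_mem_dualCone {f g : StrongDual ℝ A} (h₁ : f - g ∈ dualCone S.cone)
    (h₂ : g - f ∈ dualCone S.cone) : f = g := by
  refine eq_of_forall_mem_cone (S := S) fun x hx => le_antisymm ?_ ?_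
  · simpa using mem_dualCone.1 h₂ x hx
  · simpa using mem_dualCone.1 h₁ x hx

theorem IsAtomSplitting.isAtomicUnit {x : StrongDual ℝ A} {ω : A}
    {Q : StrongDual ℝ A →L[ℝ] StrongDual ℝ A} (h : S.IsAtomSplitting x ω Q) :
    S.IsAtomicUnit x where
  isProjectiveUnit := h.isProjectiveUnit
  ne_zero h0 := by simpa [h0] using h.isHat.apply_eq_one
  minimal y hy hy0 hle := by
    obtain ⟨σ, hσ, hyσ⟩ := hy.exists_mem_states hy0
    have h1 : y σ ≤ x σ := by simpa using mem_dualCone.1 hle σ hσ.1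
    have h2 : σ = ω := h.isHat.unique σ hσ
      (le_antisymm ((h.isProjectiveUnit.apply_le_unit hσ.1).trans_eq hσ.2) (hyσ ▸ h1))
    have h3 := h.sub_smul_mem_dualCone (t := 1) hy.mem_dualCone
      (fun z hz => by simpa using hy.apply_le_unit hz) (h2 ▸ hyσ)
    rw [one_smul] at h3
    exact eq_of_sub_mem_dualCone h3 hle

variable [FiniteDimensional ℝ A]

theorem IsAtomicUnit.exists_isAtomSplitting (hproj : S.IsProjective) {x : StrongDual ℝ A}
    (hx : S.IsAtomicUnit x) : ∃ ω Q, S.IsAtomSplitting x ω Q := by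
  obtain ⟨σ, hσ, hxσ⟩ := hx.isProjectiveUnit.exists_mem_states hx.ne_zero
  obtain ⟨ω, hω, hmax⟩ := exists_isPure_forall_le ⟨σ, hσ⟩ x
  have hxω : x ω = 1 := by
    refine le_antisymm ?_ ?_
    · exact (hx.isProjectiveUnit.apply_le_unit hω.mem_cone).trans_eq hω.unit_apply
    · simpa [hσ.2, hxσ] using hmax σ hσ.1
  obtain ⟨y, Q, hy⟩ := GPTSystem.exists_isAtomSplitting hproj hω
  have hle := hy.sub_smul_mem_dualCone (t := 1) hx.isProjectiveUnit.mem_dualCone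
    (fun z hz => by simpa using hx.isProjectiveUnit.apply_le_unit hz) hxω
  rw [one_smul] at hle
  obtain rfl := hx.minimal y hy.isProjectiveUnit hy.isAtomicUnit.ne_zero hle
  exact ⟨ω, Q, hy⟩

theorem IsAtomicUnit.exists_isHat (hproj : S.IsProjective) {x : StrongDual ℝ A}
    (hx : S.IsAtomicUnit x) : ∃ ω, S.IsHat x ω := by
  obtain ⟨ω, Q, h⟩ := hx.exists_isAtomSplitting hproj
  exact ⟨ω, h.isHat⟩

/-- A nonzero functional that is nonnegative on the cone of states is positive at some pure
state, where it attains its maximum. -/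
theorem exists_isPure_max_pos {a : StrongDual ℝ A} (ha : a ∈ dualCone S.cone) (h0 : a ≠ 0) :
    ∃ ω, S.IsPure ω ∧ 0 < a ω ∧ ∀ z ∈ S.cone, a z ≤ a ω * S.unit z := by
  obtain ⟨z, hz, haz⟩ : ∃ z ∈ S.cone, a z ≠ 0 := by
    by_contra! hcon
    exact h0 (eq_of_forall_mem_cone (S := S) fun z hz => by simp [hcon z hz])
  have hz0 : z ≠ 0 := by
    rintro rfl
    simp at haz
  obtain ⟨ω, hω, hmax⟩ := exists_isPure_forall_le ⟨_, inv_unit_smul_mem_states hz hz0⟩ a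
  have hpos : 0 < a z := (mem_dualCone.1 ha z hz).lt_of_ne' haz
  exact ⟨ω, hω, pos_of_mul_pos_left (hpos.trans_le (hmax z hz)) (S.unit_nonneg hz), hmax⟩

/-- The atomic units generate the cone of effects: subtracting from a positive functional its
maximum times the corresponding atomic unit leaves a positive functional which vanishes on a
larger subspace spanned by states. -/
theorem dualCone_le_hull (hproj : S.IsProjective) :
    dualCone S.cone ≤ PointedCone.hull ℝ {x | S.IsAtomicUnit x} := by
  suffices H : ∀ (n : ℕ) (a : StrongDual ℝ A), a ∈ dualCone S.cone →
      Module.finrank ℝ A ≤ n + Module.finrank ℝ (Submodule.span ℝ {z | z ∈ S.cone ∧ a z = 0}) →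
      a ∈ PointedCone.hull ℝ {x | S.IsAtomicUnit x} from
    fun a ha => H (Module.finrank ℝ A) a ha (by omega)
  intro n
  induction n with
  | zero =>
    intro a ha hn
    have htop := Submodule.eq_top_of_finrank_eq
      (le_antisymm (Submodule.finrank_le _) (by simpa using hn))
    have : a = 0 := by
      apply ContinuousLinearMap.coe_injective
      refine LinearMap.ext_on (f := a.toLinearMap) (g := 0) htop fun z hz => ?_
      simpa using hz.2
    rw [this]
    exact zero_mem _
  | succ n ih =>
    intro a ha hn
    by_cases h0 : a = 0
    · rw [h0]
      exact zero_mem _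
    obtain ⟨ω, hω, hpos, hmax⟩ := exists_isPure_max_pos ha h0
    obtain ⟨x, Q, hx⟩ := exists_isAtomSplitting hproj hω
    have hb := hx.sub_smul_mem_dualCone ha hmax rfl
    set b := a - a ω • x with hbdef
    have hab : a = b + a ω • x := by simp [hbdef]
    have hxnn := mem_dualCone.1 hx.isProjectiveUnit.mem_dualCone
    rw [hab]
    refine add_mem (ih b hb ?_) (PointedCone.smul_mem _ hpos.le
      (PointedCone.subset_hull hx.isAtomicUnit))
    have hlt : Submodule.span ℝ {z | z ∈ S.cone ∧ a z = 0} <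
        Submodule.span ℝ {z | z ∈ S.cone ∧ b z = 0} := by
      refine lt_of_le_of_ne (Submodule.span_mono ?_) fun heq => ?_
      · rintro z ⟨hz, haz⟩
        refine ⟨hz, le_antisymm ?_ (mem_dualCone.1 hb z hz)⟩
        have := mul_nonneg hpos.le (hxnn z hz)
        simp only [hbdef, sub_apply, smul_apply, smul_eq_mul, haz]
        linarith
      · have hmem : ω ∈ Submodule.span ℝ {z | z ∈ S.cone ∧ a z = 0} := by
          rw [heq]
          refine Submodule.subset_span ⟨hω.mem_cone, ?_⟩
          simp [hbdef, hx.isHat.apply_eq_one]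
        have hle : Submodule.span ℝ {z | z ∈ S.cone ∧ a z = 0} ≤
            LinearMap.ker a.toLinearMap := Submodule.span_le.2 fun z hz => by simpa using hz.2
        exact hpos.ne' (by simpa using hle hmem)
    have := Submodule.finrank_lt_finrank_of_lt hlt
    omega

theorem span_isAtomicUnit (hproj : S.IsProjective) :
    Submodule.span ℝ {x | S.IsAtomicUnit x} = ⊤ := by
  refine eq_top_iff.2 fun f _ => ?_
  obtain ⟨g, hg, h, hh, rfl⟩ := S.exists_sub_mem_dualCone f
  exact sub_mem (PointedCone.hull_le_span ℝ _ (dualCone_le_hull hproj hg))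
    (PointedCone.hull_le_span ℝ _ (dualCone_le_hull hproj hh))

/-! ### The hat map and its form -/

/-- The hat map exists. It is prescribed on a basis of atomic units; symmetry of transition
probabilities then identifies its value on every further atomic unit. -/
theorem exists_linearMap_isHat (hproj : S.IsProjective)
    (hstp : S.SymmetricTransitionProbabilities) :
    ∃ φ : StrongDual ℝ A →ₗ[ℝ] A, ∀ x, S.IsAtomicUnit x → S.IsHat x (φ x) := by
  classical
  have hex : ∀ x : StrongDual ℝ A, ∃ ω, S.IsAtomicUnit x → S.IsHat x ω := fun x => by
    by_cases hx : S.IsAtomicUnit x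
    · obtain ⟨ω, hω⟩ := hx.exists_isHat hproj
      exact ⟨ω, fun _ => hω⟩
    · exact ⟨0, fun h => absurd h hx⟩
  choose hat hhat using hex
  have hsym : ∀ x y, S.IsAtomicUnit x → S.IsAtomicUnit y → x (hat y) = y (hat x) :=
    fun x y hx hy => hstp _ _ (hhat x hx).pure (hhat y hy).pure x y hx
      (hhat x hx).apply_eq_one hy (hhat y hy).apply_eq_one
  let b := Module.Basis.ofSpan (span_isAtomicUnit hproj).ge
  have hb : ∀ i, S.IsAtomicUnit (b i) := fun i =>
    Module.Basis.ofSpan_subset (span_isAtomicUnit hproj).ge ⟨i, rfl⟩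
  let φ : StrongDual ℝ A →ₗ[ℝ] A := b.constr ℝ fun i => hat (b i)
  have hφ : ∀ z, S.IsAtomicUnit z → ∀ y, z (φ y) = y (hat z) := fun z hz y => by
    have : z.toLinearMap ∘ₗ φ = (topDualPairing ℝ A).flip (hat z) := by
      refine b.ext fun i => ?_
      simp only [LinearMap.comp_apply, φ, Module.Basis.constr_basis]
      exact hsym z (b i) hz (hb i)
    exact LinearMap.congr_fun this y
  refine ⟨φ, fun y hy => ?_⟩
  suffices φ y = hat y by
    rw [this]
    exact hhat y hy
  refine (SeparatingDual.eq_iff_forall_dual_eq (R := ℝ)).2 fun f => ?_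
  have hf : f ∈ Submodule.span ℝ {x | S.IsAtomicUnit x} := by simp [span_isAtomicUnit hproj]
  induction hf using Submodule.span_induction with
  | mem z hz => rw [hφ z hz y, hsym y z hy hz]
  | zero => simp
  | add f g _ _ hf hg => simp [hf, hg]
  | smul c f _ hf => simp [hf]

section HatMap

variable {φ : StrongDual ℝ A →ₗ[ℝ] A}

theorem isHatMap_of_forall_isHat (hproj : S.IsProjective)
    (h : ∀ x, S.IsAtomicUnit x → S.IsHat x (φ x)) : S.IsHatMap φ where
  positive a ha := by
    have hle : PointedCone.hull ℝ {x | S.IsAtomicUnit x} ≤ S.cone.comap φ :=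
      Submodule.span_le.2 fun x hx => (h x hx).pure.mem_cone
    exact hle (dualCone_le_hull hproj ha)
  map_atomic := h

namespace IsHatMap

theorem eq (hproj : S.IsProjective) {ψ : StrongDual ℝ A →ₗ[ℝ] A} (hψ : S.IsHatMap ψ)
    (hφ : S.IsHatMap φ) : ψ = φ :=
  LinearMap.ext_on (span_isAtomicUnit hproj) fun x hx =>
    (hφ.map_atomic x hx).unique _ (hψ.map_atomic x hx).pure.1 (hψ.map_atomic x hx).apply_eq_one

variable (hφ : S.IsHatMap φ) (hproj : S.IsProjective)
include hφ hproj

theorem pairing_comm (hstp : S.SymmetricTransitionProbabilities) (a b : StrongDual ℝ A) :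
    a (φ b) = b (φ a) := by
  have ha : a ∈ Submodule.span ℝ {x | S.IsAtomicUnit x} := by simp [span_isAtomicUnit hproj]
  have hb : b ∈ Submodule.span ℝ {x | S.IsAtomicUnit x} := by simp [span_isAtomicUnit hproj]
  induction ha, hb using Submodule.span_induction₂ with
  | mem_mem x y hx hy =>
    have hx' := hφ.map_atomic x hx
    have hy' := hφ.map_atomic y hy
    exact hstp _ _ hx'.pure hy'.pure x y hx hx'.apply_eq_one hy hy'.apply_eq_one
  | zero_left y => simp
  | zero_right x => simp
  | add_left x y z _ _ _ h₁ h₂ => simp [h₁, h₂]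
  | add_right x y z _ _ _ h₁ h₂ => simp [h₁, h₂]
  | smul_left c x y _ _ h => simp [h]
  | smul_right c x y _ _ h => simp [h]

/-- Let `t` be the largest modulus of a value of `a` on the states, attained at `ω` and, up to
sign, a value of `a`. Splitting off `t` times the atomic unit of `ω` leaves a functional `b` that
is still bounded by `t` and is orthogonal to this atomic unit for the form `a (φ b)`. -/
theorem exists_pairing_split (hstp : S.SymmetricTransitionProbabilities)
    {a : StrongDual ℝ A} (h0 : a ≠ 0) :
    ∃ t > 0, ∃ b : StrongDual ℝ A,
      (∀ s, (∀ z ∈ S.cone, |a z| ≤ s * S.unit z) → t ≤ s) ∧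
      (∀ z ∈ S.cone, |b z| ≤ t * S.unit z) ∧ a (φ a) = t ^ 2 + b (φ b) := by
  -- Up to replacing `a` by `-a`, the modulus of `a` is maximal at a maximum of `a`.
  wlog hmax : ∃ ω, S.IsPure ω ∧ ∀ z ∈ S.cone, |a z| ≤ a ω * S.unit z generalizing a with H
  · have hne : S.states.Nonempty := by
      obtain ⟨z, hz, haz⟩ : ∃ z ∈ S.cone, a z ≠ 0 := by
        by_contra! hcon
        exact h0 (eq_of_forall_mem_cone (S := S) fun z hz => by simp [hcon z hz])
      exact ⟨_, inv_unit_smul_mem_states hz (fun h => haz (by simp [h]))⟩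
    obtain ⟨ω, hω, hle⟩ := exists_isPure_forall_le hne a
    obtain ⟨σ, hσ, hle'⟩ := exists_isPure_forall_le hne (-a)
    simp only [neg_apply] at hle'
    have hneg : ∃ ω, S.IsPure ω ∧ ∀ z ∈ S.cone, |(-a) z| ≤ (-a) ω * S.unit z := by
      rcases le_total (a ω) (-a σ) with h | h
      · refine ⟨σ, hσ, fun z hz => ?_⟩
        have := mul_le_mul_of_nonneg_right h (S.unit_nonneg hz)
        rw [neg_apply, abs_neg, neg_apply]
        exact abs_le.2 ⟨by linarith [hle' z hz], by linarith [hle z hz]⟩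
      · refine absurd ⟨ω, hω, fun z hz => ?_⟩ hmax
        have := mul_le_mul_of_nonneg_right h (S.unit_nonneg hz)
        exact abs_le.2 ⟨by linarith [hle' z hz], by linarith [hle z hz]⟩
    obtain ⟨t, ht, b, h₁, h₂, h₃⟩ := H (neg_ne_zero.2 h0) hneg
    exact ⟨t, ht, b, fun s hs => h₁ s (by simpa using hs), h₂, by simpa using h₃⟩
  obtain ⟨ω, hω, hmax⟩ := hmax
  obtain ⟨x, Q, hx⟩ := exists_isAtomSplitting hproj hω
  have hpos : 0 < a ω := by
    by_contra! hle
    refine h0 (eq_of_forall_mem_cone (S := S) fun z hz => ?_)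
    have := (hmax z hz).trans (mul_nonpos_of_nonpos_of_nonneg hle (S.unit_nonneg hz))
    simpa using abs_nonpos_iff.1 this
  have hsplit := hx.split a (a ω) (fun z hz => (le_abs_self _).trans (hmax z hz)) rfl
  have hφx : φ x = ω := hx.isHat.unique _ (hφ.map_atomic x hx.isAtomicUnit).pure.1
    (hφ.map_atomic x hx.isAtomicUnit).apply_eq_one
  refine ⟨a ω, hpos, Q a, fun s hs => ?_, fun z hz => ?_, ?_⟩
  · simpa [hω.unit_apply] using le_of_abs_le (hs ω hω.mem_cone)
  · have hQ : ∀ c ∈ dualCone S.cone, 0 ≤ Q c z := fun c hc =>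
      mem_dualCone.1 (hx.projection.positive c hc) z hz
    have h₁ := hQ (a ω • S.unit - a) (by
      rw [mem_dualCone]
      intro w hw
      simpa using le_of_abs_le (hmax w hw))
    have h₂ := hQ (a ω • S.unit + a) (by
      rw [mem_dualCone]
      intro w hw
      have := neg_le_of_abs_le (hmax w hw)
      simp only [add_apply, smul_apply, smul_eq_mul]
      linarith)
    have h₃ := mul_nonneg hpos.le (mem_dualCone.1 hx.isProjectiveUnit.mem_dualCone z hz)
    simp only [map_sub, map_add, map_smul, hx.map_unit, sub_apply, add_apply, smul_apply,
      smul_eq_mul, mul_sub] at h₁ h₂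
    exact abs_le.2 ⟨by linarith, by linarith⟩
  · have hQω : (Q a) ω = 0 := by
      have := congrArg (fun f : StrongDual ℝ A => f ω) hsplit
      simp only [add_apply, smul_apply, smul_eq_mul, hx.isHat.apply_eq_one] at this
      linarith
    have hxQ : x (φ (Q a)) = 0 := by
      rw [hφ.pairing_comm hproj hstp, hφx, hQω]
    conv_lhs => rw [hsplit]
    simp only [map_add, map_smul, add_apply, smul_apply, smul_eq_mul, hφx, hQω, hxQ,
      hx.isHat.apply_eq_one]
    ring

/-- The form is positive definite. It is bounded below by `-n t²` on functionals bounded by `t`,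
for some natural number `n`; the orthogonal splitting improves such a bound from `n + 1` to `n`
until it shows that the form is nonnegative, and then that it is positive. -/
theorem pairing_self_pos (hstp : S.SymmetricTransitionProbabilities) {a : StrongDual ℝ A}
    (h0 : a ≠ 0) : 0 < a (φ a) := by
  have key : ∀ n : ℕ, (∀ (a : StrongDual ℝ A) (t : ℝ), 0 ≤ t →
      (∀ z ∈ S.cone, |a z| ≤ t * S.unit z) → -(n * t ^ 2) ≤ a (φ a)) →
      ∀ a : StrongDual ℝ A, 0 ≤ a (φ a) := by
    intro n
    induction n with
    | zero =>
      intro h a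
      obtain ⟨t, ht, hat⟩ := S.exists_abs_le_mul_unit a
      simpa using h a t ht hat
    | succ n ih =>
      refine fun h => ih fun a s hs has => ?_
      by_cases ha : a = 0
      · simp only [ha, map_zero, Left.neg_nonpos_iff]
        positivity
      obtain ⟨t, ht, b, hmin, hbt, hsq⟩ := hφ.exists_pairing_split hproj hstp ha
      have h₁ := h b t ht.le hbt
      have h₂ : n * t ^ 2 ≤ n * s ^ 2 := by
        gcongr
        exact hmin s has
      push_cast at h₁
      linarith
  -- The initial bound is `u (φ u) t²`, by positivity of `φ` on `t • u + a` and `t • u - a`.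
  have hbound : ∀ (a : StrongDual ℝ A) (t : ℝ), (∀ z ∈ S.cone, |a z| ≤ t * S.unit z) →
      -(S.unit (φ S.unit) * t ^ 2) ≤ a (φ a) := by
    intro a t hat
    have h₁ := hφ.positive (t • S.unit + a) (by
      rw [mem_dualCone]
      intro z hz
      have := neg_le_of_abs_le (hat z hz)
      simp only [add_apply, smul_apply, smul_eq_mul]
      linarith)
    have h₂ := hφ.positive (t • S.unit - a) (by
      rw [mem_dualCone]
      intro z hz
      simpa using le_of_abs_le (hat z hz))
    have h₃ := neg_le_of_abs_le (hat _ h₁)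
    have h₄ := le_of_abs_le (hat _ h₂)
    simp only [map_add, map_sub, map_smul, smul_eq_mul] at h₃ h₄
    linarith
  have hnonneg := key ⌈S.unit (φ S.unit)⌉₊ fun a t _ hat => by
    refine le_trans ?_ (hbound a t hat)
    gcongr
    exact Nat.le_ceil _
  obtain ⟨t, ht, b, -, -, hsq⟩ := hφ.exists_pairing_split hproj hstp h0
  rw [hsq]
  have := hnonneg b
  positivity

/-- The hat map reflects positivity: `φ a` is positive only if its pairing with every atomic unit is
nonnegative, which by symmetry says that `a` is nonnegative at every pure state. -/
theorem apply_mem_cone_iff (hstp : S.SymmetricTransitionProbabilities) {a : StrongDual ℝ A} :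
    φ a ∈ S.cone ↔ a ∈ dualCone S.cone := by
  refine ⟨fun h => mem_dualCone_of_forall_isPure fun ω hω => ?_, hφ.positive a⟩
  obtain ⟨x, Q, hx⟩ := exists_isAtomSplitting hproj hω
  have hφx : φ x = ω := hx.isHat.unique _ (hφ.map_atomic x hx.isAtomicUnit).pure.1
    (hφ.map_atomic x hx.isAtomicUnit).apply_eq_one
  rw [← hφx, hφ.pairing_comm hproj hstp]
  exact mem_dualCone.1 hx.isProjectiveUnit.mem_dualCone _ h

theorem isInnerProduct (hstp : S.SymmetricTransitionProbabilities) :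
    IsInnerProduct (pairingForm φ) :=
  ⟨hφ.pairing_comm hproj hstp, fun _ h0 => hφ.pairing_self_pos hproj hstp h0⟩

theorem injective (hstp : S.SymmetricTransitionProbabilities) : Function.Injective φ := by
  refine (injective_iff_map_eq_zero φ).2 fun a ha => ?_
  by_contra h0
  have := hφ.pairing_self_pos hproj hstp h0
  simp [ha] at this

/-- The hat map sends the image of a compression into the image of the filter. It suffices to
consider positive elements of the image of the compression. These form a face of the dual cone, so
they are combinations of atomic units in the image, and an atomic unit which is fixed by the
compression lies below its projective unit, whence its pure state passes the filter. -/
theorem filter_apply_adjointMap {P : A →L[ℝ] A} (hP : S.IsFilter P) (b : StrongDual ℝ A) :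
    P (φ (adjointMap P b)) = φ (adjointMap P b) := by
  suffices H : ∀ b ∈ dualCone S.cone, P (φ (adjointMap P b)) = φ (adjointMap P b) by
    obtain ⟨g, hg, h, hh, rfl⟩ := S.exists_sub_mem_dualCone b
    simp only [map_sub, H g hg, H h hh]
  intro b hb
  obtain ⟨Q, hQ, hQ₁, -, hQ₃, -⟩ := hP.exists_adjoint_complement
  have hhull : PointedCone.hull ℝ {x | S.IsAtomicUnit x} ≤ dualCone S.cone :=
    Submodule.span_le.2 fun x hx => hx.isProjectiveUnit.mem_dualCone
  have key : ∀ c ∈ PointedCone.hull ℝ {x | S.IsAtomicUnit x}, Q c = 0 → P (φ c) = φ c := by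
    intro c hc
    induction hc using Submodule.span_induction with
    | mem x hx =>
      intro h0
      have hhat := hφ.map_atomic x hx
      refine hP.apply_eq_self hhat.pure.mem_cone
        (le_antisymm (hP.unit_apply_le hhat.pure.mem_cone) ?_)
      have h₁ := hQ₁ x hx.isProjectiveUnit.mem_dualCone h0
      have h₂ := congrArg (fun f : StrongDual ℝ A => f (φ x)) h₁
      simp only [adjointMap_apply, hhat.apply_eq_one] at h₂
      rw [hhat.pure.unit_apply, ← h₂]
      exact hx.isProjectiveUnit.apply_le_unit (hP.projection.positive _ hhat.pure.mem_cone)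
    | zero => simp
    | add x y hx hy ihx ihy =>
      intro h0
      have hx' := hQ.positive x (hhull hx)
      have hy' := hQ.positive y (hhull hy)
      rw [map_add] at h0
      have hx0 : Q x = 0 := eq_of_sub_mem_dualCone (S := S) (by simpa using hx')
        (by rwa [zero_sub, neg_eq_of_add_eq_zero_right h0])
      have hy0 : Q y = 0 := by rwa [hx0, zero_add] at h0
      simp only [map_add, ihx hx0, ihy hy0]
    | smul r x hx ih =>
      intro h0
      obtain ⟨r, hr⟩ := r
      change Q (r • x) = 0 at h0
      change P (φ (r • x)) = φ (r • x)
      rw [map_smul, smul_eq_zero] at h0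
      rcases h0 with rfl | h0
      · simp
      · simp only [map_smul, ih h0]
  exact key _ (dualCone_le_hull hproj (hP.adjoint_projection.positive b hb)) (hQ₃ b hb)

/-- Compressions are symmetric for the form: since the hat map intertwines their images with those
of the filters, `(a, Tb) = (Ta, Tb)` for a compression `T`. -/
theorem pairing_adjointMap (hstp : S.SymmetricTransitionProbabilities) {P : A →L[ℝ] A}
    (hP : S.IsFilter P) (a b : StrongDual ℝ A) :
    adjointMap P a (φ b) = a (φ (adjointMap P b)) := by
  have h : ∀ a b, a (φ (adjointMap P b)) = adjointMap P a (φ (adjointMap P b)) := fun a b => by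
    rw [adjointMap_apply P a, hφ.filter_apply_adjointMap hproj hP]
  rw [hφ.pairing_comm hproj hstp, h b a, hφ.pairing_comm hproj hstp, ← h a b]

end IsHatMap

end HatMap

end GPTSystem

/-! ### Faces and perfection -/

namespace GPTSystem

variable {A : Type*} [NormedAddCommGroup A] [NormedSpace ℝ A] {S : GPTSystem A}

/-- In a projective system the faces of the cone of states are the positive images of filters. -/
theorem exists_isFilter_of_isFaceOf (hproj : S.IsProjective) {F : PointedCone ℝ A}
    (hF : F.IsFaceOf S.cone) : ∃ P, S.IsFilter P ∧ ∀ x, x ∈ F ↔ x ∈ S.cone ∧ P x = x := by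
  have hconv : Convex ℝ ((F : Set A) ∩ S.states) := by
    refine F.convex.inter (S.cone.convex.inter fun x hx y hy a b _ _ hab => ?_)
    change S.unit x = 1 at hx
    change S.unit y = 1 at hy
    change S.unit (a • x + b • y) = 1
    simp [hx, hy, hab]
  have hext : IsExtreme ℝ S.states ((F : Set A) ∩ S.states) := by
    refine ⟨Set.inter_subset_right, fun x hx y hy z hz hxy => ⟨?_, hx⟩⟩
    obtain ⟨a, b, ha, hb, -, rfl⟩ := hxy
    exact hF.mem_of_smul_add_smul_mem_left hx.1 hy.1 ha hb hz.1
  obtain ⟨P, hP, hface⟩ := hproj _ hconv hext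
  have hfix : ∀ σ ∈ S.states, σ ∈ F ↔ P σ = σ := fun σ hσ => by
    have := Set.ext_iff.1 hface σ
    simp only [Set.mem_inter_iff, hσ, and_true, SetLike.mem_coe] at this
    rw [this]
    refine ⟨?_, fun h => ⟨σ, h⟩⟩
    rintro ⟨y, rfl⟩
    exact hP.projection.idem y
  refine ⟨P, hP, fun x => ?_⟩
  by_cases h0 : x = 0
  · simp [h0]
  have hsmul : ∀ {c : ℝ}, c ≠ 0 → (P (c • x) = c • x ↔ P x = x) := fun hc => by
    rw [map_smul, smul_right_inj hc]
  have hiff : ∀ hx : x ∈ S.cone, x ∈ F ↔ P x = x := fun hx => by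
    have hpos := inv_pos.2 (unit_pos hx h0)
    rw [← hsmul hpos.ne', ← hfix _ (inv_unit_smul_mem_states hx h0), F.smul_mem_iff hpos]
  exact ⟨fun h => ⟨hF.le h, (hiff (hF.le h)).1 h⟩, fun h => (hiff h.1).2 h.2⟩

/-- The linear span of a face is the image of its filter. -/
theorem mem_span_face_iff {F : PointedCone ℝ A} {P : A →L[ℝ] A} (hP : S.IsFilter P)
    (hF : ∀ x, x ∈ F ↔ x ∈ S.cone ∧ P x = x) {x : A} :
    x ∈ Submodule.span ℝ (F : Set A) ↔ P x = x := by
  constructor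
  · intro hx
    induction hx using Submodule.span_induction with
    | mem x hx => exact ((hF x).1 hx).2
    | zero => simp
    | add x y _ _ hx hy => rw [map_add, hx, hy]
    | smul c x _ hx => rw [map_smul, hx]
  · intro hx
    have hle : Submodule.span ℝ (S.cone : Set A) ≤
        (Submodule.span ℝ (F : Set A)).comap P.toLinearMap := Submodule.span_le.2 fun y hy =>
      Submodule.subset_span ((hF _).2 ⟨hP.projection.positive y hy, hP.projection.idem y⟩)
    rw [S.regular.generates] at hle
    have := hle (Submodule.mem_top (x := x))
    rw [← hx]
    exact this

/-- An inner product for which the cone of states is self-dual and all filters are symmetric makes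
the cone perfect: a vector of the span of a face which is positive on the face is positive on the
whole cone, because the filter can be moved to the other side. -/
theorem isPerfectFor_cone (hproj : S.IsProjective) {B : LinearMap.BilinForm ℝ A}
    (hB : IsInnerProduct B) (hself : ∀ y, y ∈ S.cone ↔ ∀ x ∈ S.cone, 0 ≤ B y x)
    (hsymm : ∀ P, S.IsFilter P → ∀ x y, B (P x) y = B x (P y)) : IsPerfectFor S.cone B where
  inner := hB
  selfDual := Set.ext hself
  faces F hF := by
    obtain ⟨P, hP, hmem⟩ := exists_isFilter_of_isFaceOf hproj hF
    ext y
    simp only [SetLike.mem_coe, Set.mem_ofPred_eq, mem_span_face_iff hP hmem]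
    refine ⟨fun hy => ⟨((hmem y).1 hy).2, fun x hx => (hself y).1 (hF.le hy) x (hF.le hx)⟩, ?_⟩
    rintro ⟨hy, hpos⟩
    refine (hmem y).2 ⟨(hself y).2 fun x hx => ?_, hy⟩
    rw [← hy, hsymm P hP]
    exact hpos _ ((hmem _).2 ⟨hP.projection.positive x hx, hP.projection.idem x⟩)

theorem isOrthogonalProjection_of_isFilter {B : LinearMap.BilinForm ℝ A} {F : PointedCone ℝ A}
    {P : A →L[ℝ] A} (hP : S.IsFilter P) (hF : ∀ x, x ∈ F ↔ x ∈ S.cone ∧ P x = x)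
    (hsymm : ∀ x y, B (P x) y = B x (P y)) :
    IsOrthogonalProjection B (Submodule.span ℝ (F : Set A)) P := by
  refine fun x => ⟨(mem_span_face_iff hP hF).2 (hP.projection.idem x), fun y hy => ?_⟩
  rw [map_sub, LinearMap.sub_apply, hsymm, (mem_span_face_iff hP hF).1 hy, sub_self]

end GPTSystem

/-- Perfection is transported along linear equivalences. -/
theorem IsPerfectFor.comap {E E' : Type*} [AddCommGroup E] [Module ℝ E] [AddCommGroup E']
    [Module ℝ E'] {C : PointedCone ℝ E'} {B : LinearMap.BilinForm ℝ E'} (h : IsPerfectFor C B)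
    (e : E ≃ₗ[ℝ] E') :
    IsPerfectFor (C.comap e.toLinearMap) (B.compl₁₂ e.toLinearMap e.toLinearMap) where
  inner := ⟨fun x y => h.inner.1 _ _, fun x hx => h.inner.2 _ (by simpa using hx)⟩
  selfDual := by
    ext y
    have := Set.ext_iff.1 h.selfDual (e y)
    simpa [e.surjective.forall] using this
  faces F hF := by
    have hF' : (F.map e.toLinearMap).IsFaceOf C := by
      have := hF.map_equiv e
      have hC : (C.comap e.toLinearMap).map e.toLinearMap = C := by
        ext y
        exact ⟨fun ⟨x, hx, hxy⟩ => hxy ▸ hx,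
          fun hy => ⟨e.symm y, by simpa using hy, by simp⟩⟩
      rwa [hC] at this
    ext y
    have := Set.ext_iff.1 (h.faces _ hF') (e y)
    have hspan : e y ∈ Submodule.span ℝ (F.map e.toLinearMap : Set E') ↔
        y ∈ Submodule.span ℝ (F : Set E) := by
      rw [PointedCone.coe_map, Submodule.span_image]
      simp
    rw [Set.mem_ofPred_eq, hspan] at this
    simpa using this

theorem mainTheorem2 {A : Type*} [NormedAddCommGroup A] [NormedSpace ℝ A] [FiniteDimensional ℝ A]
    (S : GPTSystem A) (hproj : S.IsProjective) (hstp : S.SymmetricTransitionProbabilities) :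
    ∃ φ : StrongDual ℝ A →ₗ[ℝ] A,
      (S.IsHatMap φ ∧ ∀ ψ : StrongDual ℝ A →ₗ[ℝ] A, S.IsHatMap ψ → ψ = φ) ∧
      IsInnerProduct (pairingForm φ) ∧
      (∀ T : StrongDual ℝ A →L[ℝ] StrongDual ℝ A, S.IsCompression T →
        ∀ a b : StrongDual ℝ A, pairingForm φ (T a) b = pairingForm φ a (T b)) ∧
      IsPerfectFor (dualCone S.cone) (pairingForm φ) ∧
      IsPerfectCone S.cone ∧
      S.IsPerfectSystem := by
  obtain ⟨φ, hhat⟩ := GPTSystem.exists_linearMap_isHat hproj hstp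
  have hφ := GPTSystem.isHatMap_of_forall_isHat hproj hhat
  have hfin : Module.finrank ℝ (StrongDual ℝ A) = Module.finrank ℝ A :=
    (LinearMap.toContinuousLinearMap (𝕜 := ℝ) (E := A) (F' := ℝ)).finrank_eq.symm.trans
      Subspace.dual_finrank_eq
  let e : StrongDual ℝ A ≃ₗ[ℝ] A :=
    φ.linearEquivOfInjective (hφ.injective hproj hstp) hfin
  have he : ∀ a, e a = φ a := fun _ => rfl
  -- The form on `A` that makes `φ` an isometry.
  let B : LinearMap.BilinForm ℝ A :=
    (pairingForm φ).compl₁₂ e.symm.toLinearMap e.symm.toLinearMap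
  have hB : ∀ a x, B (φ a) x = a x := fun a x => by
    obtain ⟨b, rfl⟩ := e.surjective x
    simp [B, ← he]
  have hinner := hφ.isInnerProduct hproj hstp
  have hBinner : IsInnerProduct B :=
    ⟨fun x y => hinner.1 _ _, fun x hx => hinner.2 _ (by simpa using hx)⟩
  have hsymm : ∀ P, S.IsFilter P → ∀ x y, B (P x) y = B x (P y) := fun P hP x y => by
    obtain ⟨a, rfl⟩ := e.surjective x
    obtain ⟨b, rfl⟩ := e.surjective y
    rw [hBinner.1, he, he, hB, hB, ← adjointMap_apply, ← adjointMap_apply,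
      hφ.pairing_adjointMap hproj hstp hP, hφ.pairing_adjointMap hproj hstp hP,
      hφ.pairing_comm hproj hstp, ← hφ.pairing_adjointMap hproj hstp hP]
  have hperf : IsPerfectFor S.cone B := by
    refine GPTSystem.isPerfectFor_cone hproj hBinner (fun y => ?_) hsymm
    obtain ⟨a, rfl⟩ := e.surjective y
    simp only [he, hB, hφ.apply_mem_cone_iff hproj hstp, mem_dualCone]
  refine ⟨φ, ⟨hφ, fun ψ hψ => hψ.eq hproj hφ⟩, hinner, ?_, ?_, ⟨B, hperf⟩, B, hperf,
    fun F hF => ?_⟩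
  · rintro T ⟨P, hP, rfl⟩ a b
    exact hφ.pairing_adjointMap hproj hstp hP a b
  · convert hperf.comap e using 1
    · ext a
      exact (hφ.apply_mem_cone_iff hproj hstp).symm
    · refine LinearMap.ext₂ fun a b => ?_
      simp [B]
  · obtain ⟨P, hP, hmem⟩ := GPTSystem.exists_isFilter_of_isFaceOf hproj hF
    exact ⟨P, GPTSystem.isOrthogonalProjection_of_isFilter hP hmem (hsymm P hP), hP.normalized⟩
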